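/- Let $N\in\mathbb{N}$ and let $\rho:\mathbb{R}^N\to\mathbb{R}$ be a weight: a positive, continuous, bounded function with $\int_{\mathbb{R}^N}\rho\,dx<\infty$. Let $C_\rho(\mathbb{R}^N)$ be the space of continuous $u:\mathbb{R}^N\to\mathbb{R}$ with $\|u\|_\rho:=\sup_x |u(x)|\rho(x)<\infty$, with the norm $\|\cdot\|_\rho$. Let $J:\mathbb{R}^N\to\mathbb{R}$ be non-negative, even and integrable, let $h:\mathbb{R}^N\to\mathbb{R}$ be continuous and bounded, and let $f:\mathbb{R}\to\mathbb{R}$ be globally Lipschitz, bounded, differentiable and strictly increasing. Let $\eta,K,\delta\in\mathbb{R}$ be such that $|f(s)|\le\eta|s|+K$ for all $s\in\mathbb{R}$ and $\|J\|_{L^1}\|\rho\|_\infty\,\eta<\delta<1$. Put $$(J*_\rho v)(x)=\int_{\mathbb{R}^N}J(x-y)v(y)\rho(y)\,dy,\qquad R=\frac{\|J\|_{L^1}\|\rho\|_\infty^2K+\|h\|_\rho}{\delta-\|J\|_{L^1}\|\rho\|_\infty\,\eta},$$ $$E=\{u\in C_\rho(\mathbb{R}^N):\ \|u\|_\rho\le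 R,\ u=J*_\rho(f\circ u)+h\}.$$ Then the equation $\partial_t u=-u+J*_\rho(f\circ u)+h$ generates a continuous flow $T(t)$, $t\in\mathbb{R}$, in $C_\rho(\mathbb{R}^N)$, that is, the curves $u:\mathbb{R}\to C_\rho(\mathbb{R}^N)$ which are differentiable in the norm $\|\cdot\|_\rho$ and satisfy the equation for all $t\in\mathbb{R}$ are exactly the curves $u(t)=T(t)u_0$ with $u_0\in C_\rho(\mathbb{R}^N)$. For every $u\in C_\rho(\mathbb{R}^N)$, $$\omega(u)=\bigcap_{s\in\mathbb{R}}\overline{\{T(t)u: t\ge s\}}\subseteq E\qquad\text{and}\qquad \alpha(u)=\bigcap_{s\in\mathbb{R}}\overline{\{T(t)u: t\le s\}}\subseteq E .$$ -/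

import Mathlib

open MeasureTheory Filter

/-- A weight on `ℝ^N`: a positive, continuous, bounded, Lebesgue integrable function. -/
structure Weight (N : ℕ) where
  toFun : EuclideanSpace ℝ (Fin N) → ℝ
  continuous_toFun : Continuous toFun
  pos : ∀ x, 0 < toFun x
  bounded : ∃ C, ∀ x, toFun x ≤ C
  integrable : Integrable toFun

instance {N : ℕ} : CoeFun (Weight N) (fun _ => EuclideanSpace ℝ (Fin N) → ℝ) := ⟨Weight.toFun⟩

/-- `‖g‖_ρ = sup_x |g x| ρ x`. -/
noncomputable def rhoNorm {N : ℕ} (ρ : Weight N) (g : EuclideanSpace ℝ (Fin N) → ℝ) : ℝ :=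
  ⨆ x, |g x| * ρ x

/-- `‖ρ‖_∞`. -/
noncomputable def Weight.supNorm {N : ℕ} (ρ : Weight N) : ℝ := ⨆ x, ρ x

/-- The linear space of continuous `u` with `|u| ρ` bounded. -/
def cRhoSubmodule {N : ℕ} (ρ : Weight N) : Submodule ℝ C(EuclideanSpace ℝ (Fin N), ℝ) where
  carrier := {u | BddAbove (Set.range fun x => |u x| * ρ x)}
  zero_mem' := ⟨0, by rintro _ ⟨x, rfl⟩; simp⟩
  add_mem' := by
    rintro u v ⟨a, ha⟩ ⟨b, hb⟩
    refine ⟨a + b, ?_⟩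
    rintro _ ⟨x, rfl⟩
    have h1 := ha ⟨x, rfl⟩
    have h2 := hb ⟨x, rfl⟩
    have h3 := mul_le_mul_of_nonneg_right (abs_add_le (u x) (v x)) (ρ.pos x).le
    simp only [ContinuousMap.add_apply] at *
    linarith
  smul_mem' := by
    rintro c u ⟨a, ha⟩
    refine ⟨|c| * a, ?_⟩
    rintro _ ⟨x, rfl⟩
    have h1 := mul_le_mul_of_nonneg_left (ha ⟨x, rfl⟩) (abs_nonneg c)
    simp only [ContinuousMap.smul_apply, smul_eq_mul, abs_mul] at *
    linarith

/-- The space `C_ρ(ℝ^N)`. It is a type of its own so that its topology is that of `‖·‖_ρ`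
and not the compact-open one. -/
def CRho {N : ℕ} (ρ : Weight N) : Type := ↥(cRhoSubmodule ρ)

namespace CRho

variable {N : ℕ} {ρ : Weight N}

instance : AddCommGroup (CRho ρ) := inferInstanceAs (AddCommGroup ↥(cRhoSubmodule ρ))

instance : Module ℝ (CRho ρ) := inferInstanceAs (Module ℝ ↥(cRhoSubmodule ρ))

instance : CoeFun (CRho ρ) (fun _ => EuclideanSpace ℝ (Fin N) → ℝ) := ⟨fun u => u.1⟩

theorem continuous (u : CRho ρ) : Continuous u := u.1.continuous

theorem bddAbove (u : CRho ρ) : BddAbove (Set.range fun x => |u x| * ρ x) := u.2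

@[ext] theorem ext {u v : CRho ρ} (h : ∀ x, u x = v x) : u = v :=
  Subtype.ext (ContinuousMap.ext h)

@[simp] theorem zero_apply (x : EuclideanSpace ℝ (Fin N)) : (0 : CRho ρ) x = 0 := rfl

@[simp] theorem add_apply (u v : CRho ρ) (x : EuclideanSpace ℝ (Fin N)) :
    (u + v) x = u x + v x := rfl

@[simp] theorem neg_apply (u : CRho ρ) (x : EuclideanSpace ℝ (Fin N)) : (-u) x = -u x := rfl

@[simp] theorem smul_apply (c : ℝ) (u : CRho ρ) (x : EuclideanSpace ℝ (Fin N)) :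
    (c • u) x = c * u x := rfl

theorem le_rhoNorm (u : CRho ρ) (x : EuclideanSpace ℝ (Fin N)) : |u x| * ρ x ≤ rhoNorm ρ u :=
  le_ciSup u.bddAbove x

noncomputable instance : NormedAddCommGroup (CRho ρ) :=
  AddGroupNorm.toNormedAddCommGroup
    { toFun := fun u => rhoNorm ρ u
      map_zero' := by simp [rhoNorm]
      add_le' := fun u v => ciSup_le fun x => by
        have h1 := u.le_rhoNorm x
        have h2 := v.le_rhoNorm x
        have h3 := mul_le_mul_of_nonneg_right (abs_add_le (u x) (v x)) (ρ.pos x).le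
        simp only [add_apply] at *
        linarith
      neg' := fun u => by simp [rhoNorm]
      eq_zero_of_map_eq_zero' := fun u hu => by
        ext x
        have h1 := u.le_rhoNorm x
        have h2 := ρ.pos x
        have h3 := abs_nonneg (u x)
        have hu' : rhoNorm ρ u = 0 := hu
        rw [hu'] at h1
        have h4 : |u x| = 0 := by nlinarith
        simpa using h4 }

theorem norm_def (u : CRho ρ) : ‖u‖ = rhoNorm ρ u := rfl

noncomputable instance : NormedSpace ℝ (CRho ρ) where
  norm_smul_le c u := by
    rw [norm_def, norm_def, Real.norm_eq_abs]
    refine ciSup_le fun x => ?_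
    have h1 := mul_le_mul_of_nonneg_left (u.le_rhoNorm x) (abs_nonneg c)
    simp only [smul_apply, abs_mul]
    linarith

end CRho

/-- `(J *_ρ v)(x) = ∫ J(x - y) v(y) ρ(y) dy`. -/
noncomputable def convRho {N : ℕ} (ρ : Weight N) (J v : EuclideanSpace ℝ (Fin N) → ℝ)
    (x : EuclideanSpace ℝ (Fin N)) : ℝ :=
  ∫ y, J (x - y) * v y * ρ y

/-- `u : ℝ → C_ρ` solves `∂u/∂t = -u + J *_ρ (f ∘ u) + h` for all times, the time derivative
being taken in `C_ρ`. -/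
def IsSolution {N : ℕ} (ρ : Weight N) (J : EuclideanSpace ℝ (Fin N) → ℝ) (f : ℝ → ℝ)
    (h : EuclideanSpace ℝ (Fin N) → ℝ) (u : ℝ → CRho ρ) : Prop :=
  ∀ t, ∃ w : CRho ρ,
    (∀ x, w x = -u t x + convRho ρ J (fun y => f (u t y)) x + h x) ∧ HasDerivAt u w t

/-- `T` is the flow generated by the equation: its orbits are exactly the solutions. -/
def IsFlowOfEquation {N : ℕ} (ρ : Weight N) (J : EuclideanSpace ℝ (Fin N) → ℝ) (f : ℝ → ℝ)
    (h : EuclideanSpace ℝ (Fin N) → ℝ) (T : Flow ℝ (CRho ρ)) : Prop :=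
  ∀ u : ℝ → CRho ρ, IsSolution ρ J f h u ↔ ∀ t, u t = T t (u 0)

/-- The equilibria in the closed ball of radius `R` of `C_ρ`. -/
def equilibriumSet {N : ℕ} (ρ : Weight N) (J : EuclideanSpace ℝ (Fin N) → ℝ) (f : ℝ → ℝ)
    (h : EuclideanSpace ℝ (Fin N) → ℝ) (R : ℝ) : Set (CRho ρ) :=
  {u | ‖u‖ ≤ R ∧ ∀ x, u x = convRho ρ J (fun y => f (u y)) x + h x}

/-! ### Flows of `u' = -u + B u` in a Banach space. -/

section LinearPlusBounded

open Set Topology NNReal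

/-! On the Banach space C_ρ the field is -u plus a bounded Lipschitz map, so it generates a global
flow (`exists_flow`). The limit sets are treated by LaSalle's principle with the functional
`energy`. By `hasDerivAt_energy` its derivative along a bounded orbit v is -∫ ρ f'(v) (∂_t v)²,
because J is even.

Elements of C_ρ may be unbounded, and then the energy need not make sense. Variation of constants at
each point (`abs_flow_sub_le`) gives |T(t)u - e^{-(t-s)} T(s)u| ≤ b for s ≤ t, with b independent of
u, x, s and t. Forward in time, T(t)u - e^{-t}u is therefore bounded, and its energy plus C e^{-t}
decreases (`antitoneOn_energy`), so the energy converges. Backward in time, a point of α(u) makes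
T(τ_n)u converge along some τ_n → -∞. Letting s = τ_n shows that the whole orbit is bounded by b,
and its energy is monotone and bounded. The energy passes to pointwise limits of uniformly bounded
functions (`tendsto_energy`), so no compactness of orbits is needed: the orbit of a limit point w is
bounded and has constant energy (`eq_rhs_of_tendsto`).

Since f' may have zeros, constant energy yields only f'(T(t)w) ∂_t T(t)w = 0 almost everywhere. This
product is the time derivative of f(T(t)w), so ∫ ρ (f(T(t)w) - f(w))² stays 0, and injectivity of f
gives T(t)w = w (`eq_rhs_of_energy_const`). The constants η, K, δ enter only in the norm bound for
equilibria (`norm_equilibrium_le`). -/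

theorem LipschitzWith.neg_id_add {E : Type*} [NormedAddCommGroup E] {B : E → E} {k : ℝ≥0}
    (hB : LipschitzWith k B) :
    LipschitzWith (1 + k) fun x => -x + B x :=
  (LipschitzWith.id.neg).add hB

variable {E : Type*} [NormedAddCommGroup E] [NormedSpace ℝ E]

/-- Solutions of an autonomous Lipschitz equation separate at most exponentially, in both time
directions. -/
theorem dist_le_exp_of_autonomous {F : E → E} {L : ℝ≥0} (hF : LipschitzWith L F) {u w : ℝ → E}
    (hu : ∀ t, HasDerivAt u (F (u t)) t) (hw : ∀ t, HasDerivAt w (F (w t)) t) (t : ℝ) :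
    dist (u t) (w t) ≤ dist (u 0) (w 0) * Real.exp (L * |t|) := by
  rcases le_total 0 t with ht | ht
  · have := dist_le_of_trajectories_ODE (v := fun _ => F) (f := u) (g := w) (a := 0) (b := t)
      (fun _ => hF) (fun s _ => (hu s).continuousAt.continuousWithinAt)
      (fun s _ => (hu s).hasDerivWithinAt) (fun s _ => (hw s).continuousAt.continuousWithinAt)
      (fun s _ => (hw s).hasDerivWithinAt) le_rfl t ⟨ht, le_rfl⟩
    simpa [abs_of_nonneg ht] using this
  -- Time reversal turns F into -F, which has the same Lipschitz constant.
  · have rev : ∀ {g : ℝ → E}, (∀ t, HasDerivAt g (F (g t)) t) →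
        ∀ s, HasDerivAt (fun s => g (-s)) (-F (g (-s))) s := fun {g} hg s => by
      simpa [Function.comp_def] using (hg (-s)).scomp s (hasDerivAt_neg s)
    have := dist_le_of_trajectories_ODE (v := fun _ x => -F x) (f := fun s => u (-s))
      (g := fun s => w (-s)) (a := 0) (b := -t)
      (fun _ => hF.neg) (fun s _ => (rev hu s).continuousAt.continuousWithinAt)
      (fun s _ => (rev hu s).hasDerivWithinAt)
      (fun s _ => (rev hw s).continuousAt.continuousWithinAt)
      (fun s _ => (rev hw s).hasDerivWithinAt) le_rfl (-t) ⟨by linarith, le_rfl⟩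
    simpa [abs_of_nonpos ht] using this

theorem eq_of_autonomous {F : E → E} {L : ℝ≥0} (hF : LipschitzWith L F) {u w : ℝ → E}
    (hu : ∀ t, HasDerivAt u (F (u t)) t) (hw : ∀ t, HasDerivAt w (F (w t)) t)
    (h0 : u 0 = w 0) (t : ℝ) : u t = w t := by
  have := dist_le_exp_of_autonomous hF hu hw t
  rw [h0, dist_self, zero_mul] at this
  exact dist_le_zero.1 this

/-- With y = e^t u the linear term disappears: y' = e^t B(e^{-t} y). This field has Lipschitz
constant k at every time and is bounded by e^S C on [-S, S]. A solution moves by at most e^S C S, so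
Picard–Lindelöf on the ball of that radius reaches the whole interval at once. -/
theorem exists_solution_Ioo [CompleteSpace E] {B : E → E} {k : ℝ≥0} (hB : LipschitzWith k B)
    {C : ℝ} (hC : ∀ x, ‖B x‖ ≤ C) (x₀ : E) {S : ℝ} (hS : 0 < S) :
    ∃ u : ℝ → E, u 0 = x₀ ∧ ∀ t ∈ Ioo (-S) S, HasDerivAt u (-u t + B (u t)) t := by
  have hC0 : 0 ≤ C := (norm_nonneg _).trans (hC x₀)
  have hpl : IsPicardLindelof (fun t y => Real.exp t • B (Real.exp (-t) • y))
      (tmin := -S) (tmax := S) ⟨0, by simp [hS.le]⟩ x₀ (Real.toNNReal (Real.exp S * C * S)) 0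
      (Real.toNNReal (Real.exp S * C)) k := by
    refine ⟨fun t _ => (LipschitzWith.of_dist_le_mul fun y z => ?_).lipschitzOnWith,
      fun y _ => ?_, fun t ht y _ => ?_, ?_⟩
    · rw [dist_smul₀, Real.norm_eq_abs, Real.abs_exp]
      calc Real.exp t * dist (B (Real.exp (-t) • y)) (B (Real.exp (-t) • z))
          ≤ Real.exp t * (k * dist (Real.exp (-t) • y) (Real.exp (-t) • z)) := by
            gcongr; exact hB.dist_le_mul _ _
        _ = (Real.exp t * Real.exp (-t)) * (k * dist y z) := by
            rw [dist_smul₀, Real.norm_eq_abs, Real.abs_exp]; ring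
        _ = k * dist y z := by rw [← Real.exp_add]; simp
    · exact (Real.continuous_exp.smul (hB.continuous.comp
        ((Real.continuous_exp.comp continuous_neg).smul continuous_const))).continuousOn
    · rw [norm_smul, Real.norm_eq_abs, Real.abs_exp, Real.coe_toNNReal _ (by positivity)]
      gcongr
      · exact ht.2
      · exact hC _
    · rw [Real.coe_toNNReal _ (by positivity), Real.coe_toNNReal _ (by positivity)]
      simp
  obtain ⟨y, hy0, hy⟩ := hpl.exists_eq_forall_mem_Icc_hasDerivWithinAt₀
  refine ⟨fun t => Real.exp (-t) • y t, by simpa using hy0, fun t ht => ?_⟩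
  have h1 := (hy t (Ioo_subset_Icc_self ht)).hasDerivAt (Icc_mem_nhds ht.1 ht.2)
  have h2 : HasDerivAt (fun t : ℝ => Real.exp (-t)) (-Real.exp (-t)) t := by
    simpa using (hasDerivAt_neg t).exp
  refine (h2.smul h1).congr_deriv ?_
  rw [smul_smul, ← Real.exp_add]
  simp [add_comm]

theorem exists_global_solution [CompleteSpace E] {B : E → E} {k : ℝ≥0} (hB : LipschitzWith k B)
    {C : ℝ} (hC : ∀ x, ‖B x‖ ≤ C) (x₀ : E) :
    ∃ u : ℝ → E, u 0 = x₀ ∧ ∀ t, HasDerivAt u (-u t + B (u t)) t := by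
  -- The half-length is n + 1, so that the interval is nonempty for n = 0 and ⌈|t|⌉ ≤ n puts t in
  -- its interior. Uniqueness makes the local solutions compatible.
  have hpos : ∀ n : ℕ, (0 : ℝ) < n + 1 := fun n => by positivity
  choose U hU0 hU using fun n : ℕ => exists_solution_Ioo hB hC x₀ (hpos n)
  have agree : ∀ m n : ℕ, m ≤ n → ∀ t ∈ Ioo (-((m : ℝ) + 1)) (m + 1), U m t = U n t := by
    intro m n hmn t ht
    have hmn' : (m : ℝ) ≤ n := by exact_mod_cast hmn
    refine ODE_solution_unique_of_mem_Ioo (v := fun _ x => -x + B x) (s := fun _ => univ)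
      (fun t _ => hB.neg_id_add.lipschitzOnWith) (t₀ := 0) ⟨by linarith [hpos m], hpos m⟩
      (fun s hs => ⟨hU m s hs, mem_univ _⟩)
      (fun s hs => ⟨hU n s ⟨by linarith [hs.1], by linarith [hs.2]⟩, mem_univ _⟩)
      (by rw [hU0, hU0]) ht
  have mem : ∀ t : ℝ, ∀ n : ℕ, ⌈|t|⌉₊ ≤ n → t ∈ Ioo (-((n : ℝ) + 1)) (n + 1) := fun t n hn => by
    have h1 := Nat.le_ceil |t|
    have h2 : ((⌈|t|⌉₊ : ℕ) : ℝ) ≤ n := by exact_mod_cast hn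
    exact abs_lt.1 (by linarith)
  have key : ∀ t : ℝ, ∀ n : ℕ, t ∈ Ioo (-((n : ℝ) + 1)) (n + 1) → U ⌈|t|⌉₊ t = U n t :=
    fun t n ht => by
      rcases le_total ⌈|t|⌉₊ n with h | h
      · exact agree _ _ h t (mem t _ le_rfl)
      · exact (agree _ _ h t ht).symm
  refine ⟨fun t => U ⌈|t|⌉₊ t, hU0 _, fun t => ?_⟩
  refine (hU ⌈|t|⌉₊ t (mem t _ le_rfl)).congr_of_eventuallyEq ?_
  filter_upwards [Ioo_mem_nhds (mem t _ le_rfl).1 (mem t _ le_rfl).2] with s hs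
  exact key s _ hs

/-- The equation `u' = -u + B u` with `B` Lipschitz and bounded generates a flow. -/
theorem exists_flow [CompleteSpace E] {B : E → E} {k : ℝ≥0} (hB : LipschitzWith k B)
    {C : ℝ} (hC : ∀ x, ‖B x‖ ≤ C) :
    ∃ T : Flow ℝ E, ∀ u : ℝ → E,
      (∀ t, HasDerivAt u (-u t + B (u t)) t) ↔ ∀ t, u t = T t (u 0) := by
  choose S hS0 hS using exists_global_solution hB hC
  have hF := hB.neg_id_add
  refine ⟨⟨fun t x => S x t, ?_, fun t₁ t₂ x => ?_, hS0⟩, fun u => ⟨fun hu t => ?_, fun hu t => ?_⟩⟩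
  · rw [continuous_iff_continuousAt]
    rintro ⟨t₀, x₀⟩
    -- Joint continuity: exponential separation compares two orbits at the same time, and continuity
    -- of the single orbit of x₀ handles the change of time.
    refine tendsto_iff_dist_tendsto_zero.2 (squeeze_zero (fun _ => dist_nonneg) (g :=
    fun p : ℝ × E =>
      dist p.2 x₀ * Real.exp ((1 + k : ℝ≥0) * |p.1|) + dist (S x₀ p.1) (S x₀ t₀)) (fun p => ?_) ?_)
    · refine (dist_triangle _ (S x₀ p.1) _).trans (add_le_add_left ?_ _)
      simpa [hS0, Function.uncurry] using dist_le_exp_of_autonomous hF (hS p.2) (hS x₀) p.1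
    · have hc : Continuous (S x₀) := continuous_iff_continuousAt.2 fun t => (hS x₀ t).continuousAt
      have : Continuous fun p : ℝ × E =>
          dist p.2 x₀ * Real.exp ((1 + k : ℝ≥0) * |p.1|) + dist (S x₀ p.1) (S x₀ t₀) := by
        fun_prop
      simpa using this.tendsto (t₀, x₀)
  · refine eq_of_autonomous hF (u := fun t => S x (t + t₂)) (fun t => ?_) (hS (S x t₂))
      (by simp [hS0]) t₁
    exact (hS x (t + t₂)).comp_add_const t t₂
  · exact eq_of_autonomous hF hu (hS (u 0)) (hS0 _).symm t
  · have h : u = S (u 0) := funext hu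
    have := hS (u 0) t
    rwa [← h] at this

end LinearPlusBounded

/-! ### The space C_ρ, its completeness, and the flow of the equation. -/

section WeightedSpace

open Set Topology NNReal

variable {N : ℕ} {ρ : Weight N}

theorem Weight.le_supNorm (ρ : Weight N) (x : EuclideanSpace ℝ (Fin N)) : ρ x ≤ ρ.supNorm :=
  le_ciSup (f := fun x => ρ x) (by obtain ⟨C, hC⟩ := ρ.bounded; exact ⟨C, by rintro _ ⟨x, rfl⟩; exact hC x⟩) x

theorem Weight.supNorm_nonneg (ρ : Weight N) : 0 ≤ ρ.supNorm :=
  (ρ.pos 0).le.trans (ρ.le_supNorm 0)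

namespace CRho

theorem abs_apply_le (u : CRho ρ) (x : EuclideanSpace ℝ (Fin N)) : |u x| ≤ (ρ x)⁻¹ * ‖u‖ := by
  rw [inv_mul_eq_div, le_div_iff₀ (ρ.pos x)]
  exact u.le_rhoNorm x

theorem norm_le_of_forall {u : CRho ρ} {C : ℝ} (hu : ∀ x, |u x| * ρ x ≤ C) : ‖u‖ ≤ C :=
  ciSup_le hu

@[simp] theorem sub_apply (u v : CRho ρ) (x : EuclideanSpace ℝ (Fin N)) : (u - v) x = u x - v x :=
    by
  rw [sub_eq_add_neg, add_apply, neg_apply, sub_eq_add_neg]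

/-- Evaluation at a point is a continuous functional on `C_ρ`. -/
noncomputable def evalCLM (ρ : Weight N) (x : EuclideanSpace ℝ (Fin N)) : CRho ρ →L[ℝ] ℝ :=
  LinearMap.mkContinuous
    { toFun := fun u => u x
      map_add' := fun _ _ => rfl
      map_smul' := fun _ _ => rfl } (ρ x)⁻¹ fun u => u.abs_apply_le x

theorem hasDerivAt_apply {u : ℝ → CRho ρ} {w : CRho ρ} {t : ℝ} (hu : HasDerivAt u w t)
    (x : EuclideanSpace ℝ (Fin N)) :
    HasDerivAt (fun s => u s x) (w x) t :=
  (evalCLM ρ x).hasFDerivAt.comp_hasDerivAt t hu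

theorem tendsto_apply {ι : Type*} {l : Filter ι} {u : ι → CRho ρ} {w : CRho ρ}
    (hu : Tendsto u l (𝓝 w)) (x : EuclideanSpace ℝ (Fin N)) :
    Tendsto (fun i => u i x) l (𝓝 (w x)) :=
  ((evalCLM ρ x).continuous.tendsto w).comp hu

/-- A continuous function with `|g| ρ` bounded, as an element of `C_ρ`. -/
def mk (g : EuclideanSpace ℝ (Fin N) → ℝ) (hg : Continuous g) (C : ℝ) (hC : ∀ x, |g x| * ρ x ≤ C) :
    CRho ρ :=
  ⟨⟨g, hg⟩, C, by rintro _ ⟨x, rfl⟩; exact hC x⟩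

/-- The bounded continuous function `u ρ`. -/
noncomputable def toBCF (u : CRho ρ) : BoundedContinuousFunction (EuclideanSpace ℝ (Fin N)) ℝ :=
  BoundedContinuousFunction.ofNormedAddCommGroup (fun x => u x * ρ x)
    (u.continuous.mul ρ.continuous_toFun) ‖u‖ fun x => by
      rw [norm_mul, Real.norm_eq_abs, Real.norm_of_nonneg (ρ.pos x).le]; exact u.le_rhoNorm x

/-- Multiplication by `ρ` identifies `C_ρ` with the bounded continuous functions. -/
noncomputable def equivBCF (ρ : Weight N) :
    CRho ρ ≃ᵢ BoundedContinuousFunction (EuclideanSpace ℝ (Fin N)) ℝ where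
  toFun := toBCF
  invFun g := mk (fun x => g x / ρ x)
    (g.continuous.div₀ ρ.continuous_toFun fun x => (ρ.pos x).ne') ‖g‖ fun x => by
      rw [abs_div, abs_of_pos (ρ.pos x), div_mul_cancel₀ _ (ρ.pos x).ne']; exact g.norm_coe_le_norm x
  left_inv u := by ext x; exact mul_div_cancel_right₀ _ (ρ.pos x).ne'
  right_inv g := by ext x; exact div_mul_cancel₀ _ (ρ.pos x).ne'
  isometry_toFun := by
    refine Isometry.of_dist_eq fun u v => ?_
    rw [dist_eq_norm u v]
    have e : ∀ x, |u x * ρ x - v x * ρ x| = |(u - v) x| * ρ x := fun x => by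
      rw [sub_apply, ← sub_mul, abs_mul, abs_of_pos (ρ.pos x)]
    refine le_antisymm ((BoundedContinuousFunction.dist_le (norm_nonneg _)).2 fun x => ?_)
      (norm_le_of_forall fun x => ?_)
    · exact (e x).trans_le ((u - v).le_rhoNorm x)
    · rw [← e x]
      exact BoundedContinuousFunction.dist_coe_le_dist (f := u.toBCF) (g := v.toBCF) x

instance : CompleteSpace (CRho ρ) := (equivBCF ρ).completeSpace

end CRho

/-! ### Estimates for the weighted convolution. -/

section Convolution

variable {J : EuclideanSpace ℝ (Fin N) → ℝ}

theorem integrable_convRho (hJ : Integrable J) {p : EuclideanSpace ℝ (Fin N) → ℝ}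
    (hp : Measurable p) {A : ℝ}
    (hA : ∀ y, |p y| * ρ y ≤ A) (x : EuclideanSpace ℝ (Fin N)) :
    Integrable fun y => J (x - y) * p y * ρ y := by
  simp_rw [mul_assoc]
  refine (hJ.comp_sub_left x).mul_bdd (c := A)
    (hp.mul ρ.continuous_toFun.measurable).aestronglyMeasurable (ae_of_all _ fun y => ?_)
  rw [norm_mul, Real.norm_eq_abs, Real.norm_of_nonneg (ρ.pos y).le]
  exact hA y

theorem abs_convRho_le (hJ0 : ∀ x, 0 ≤ J x) (hJ : Integrable J)
    {p : EuclideanSpace ℝ (Fin N) → ℝ} {A : ℝ}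
    (hA : ∀ y, |p y| * ρ y ≤ A) (x : EuclideanSpace ℝ (Fin N)) : |convRho ρ J p x| ≤ (∫ y,
    J y) * A := by
  rw [← integral_sub_left_eq_self J volume x, ← integral_mul_const, ← Real.norm_eq_abs]
  refine norm_integral_le_of_norm_le ((hJ.comp_sub_left x).mul_const A) (ae_of_all _ fun y => ?_)
  rw [mul_assoc, norm_mul, norm_mul, Real.norm_of_nonneg (hJ0 _), Real.norm_eq_abs (p y),
    Real.norm_of_nonneg (ρ.pos y).le]
  exact mul_le_mul_of_nonneg_left (hA y) (hJ0 _)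

theorem convRho_sub (hJ : Integrable J) {p q : EuclideanSpace ℝ (Fin N) → ℝ}
    (hp : Measurable p) (hq : Measurable q)
    {A : ℝ} (hA : ∀ y, |p y| * ρ y ≤ A) (hA' : ∀ y, |q y| * ρ y ≤ A)
    (x : EuclideanSpace ℝ (Fin N)) :
    convRho ρ J p x - convRho ρ J q x = convRho ρ J (fun y => p y - q y) x := by
  unfold convRho
  rw [← integral_sub (integrable_convRho hJ hp hA x) (integrable_convRho hJ hq hA' x)]
  congr 1
  ext y
  ring

/-- This is the ordinary convolution of the L¹ function J with the bounded continuous function p ρ.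
-/
theorem continuous_convRho (hJ : Integrable J) {p : EuclideanSpace ℝ (Fin N) → ℝ}
    (hp : Continuous p) {A : ℝ}
    (hA : ∀ y, |p y| * ρ y ≤ A) : Continuous (convRho ρ J p) := by
  have hb : BddAbove (range fun y => ‖p y * ρ y‖) := ⟨A, by
    rintro _ ⟨y, rfl⟩
    dsimp only
    rw [norm_mul, Real.norm_eq_abs, Real.norm_of_nonneg (ρ.pos y).le]
    exact hA y⟩
  have := hb.continuous_convolution_right_of_integrable (μ := volume)
    (ContinuousLinearMap.mul ℝ ℝ) hJ (hp.mul ρ.continuous_toFun)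
  convert this using 1
  ext x
  rw [convolution_eq_swap]
  simp [convRho, mul_assoc]

end Convolution

/-- The standing assumptions on the data of the equation, with explicit bounds. -/
structure IsFieldData (J : EuclideanSpace ℝ (Fin N) → ℝ) (f : ℝ → ℝ)
    (h : EuclideanSpace ℝ (Fin N) → ℝ) (k : ℝ≥0) (M H : ℝ) : Prop where
  J_nonneg : ∀ x, 0 ≤ J x
  J_int : Integrable J
  J_even : ∀ x, J (-x) = J x
  h_cont : Continuous h
  h_le : ∀ x, |h x| ≤ H
  f_lip : LipschitzWith k f
  f_le : ∀ s, |f s| ≤ M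
  f_mono : StrictMono f
  f_diff : Differentiable ℝ f

namespace IsFieldData

variable {J : EuclideanSpace ℝ (Fin N) → ℝ} {f : ℝ → ℝ} {h : EuclideanSpace ℝ (Fin N) → ℝ}
    {k : ℝ≥0} {M H : ℝ}

/-- A uniform bound of `J *_ρ (f ∘ u) + h`. -/
noncomputable def bound (ρ : Weight N) (J : EuclideanSpace ℝ (Fin N) → ℝ) (M H : ℝ) : ℝ :=
  (∫ y, J y) * (M * ρ.supNorm) + H

section

variable (D : IsFieldData J f h k M H)
include D

theorem M_nonneg : 0 ≤ M := (abs_nonneg _).trans (D.f_le 0)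

theorem H_nonneg : 0 ≤ H := (abs_nonneg _).trans (D.h_le 0)

theorem integral_J_nonneg : 0 ≤ ∫ y, J y := integral_nonneg D.J_nonneg

theorem bound_nonneg : 0 ≤ bound ρ J M H :=
  add_nonneg (mul_nonneg D.integral_J_nonneg (mul_nonneg D.M_nonneg ρ.supNorm_nonneg)) D.H_nonneg

theorem abs_mul_le (u : EuclideanSpace ℝ (Fin N) → ℝ) (y : EuclideanSpace ℝ (Fin N)) :
    |f (u y)| * ρ y ≤ M * ρ.supNorm :=
  mul_le_mul (D.f_le _) (ρ.le_supNorm y) (ρ.pos y).le D.M_nonneg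

theorem abs_rhs_le (u : EuclideanSpace ℝ (Fin N) → ℝ) (x : EuclideanSpace ℝ (Fin N)) :
    |convRho ρ J (fun y => f (u y)) x + h x| ≤ bound ρ J M H :=
  (abs_add_le _ _).trans
    (add_le_add (abs_convRho_le D.J_nonneg D.J_int (D.abs_mul_le u) x) (D.h_le x))

theorem continuous_rhs {u : EuclideanSpace ℝ (Fin N) → ℝ} (hu : Continuous u) :
    Continuous fun x => convRho ρ J (fun y => f (u y)) x + h x :=
  (continuous_convRho D.J_int (D.f_diff.continuous.comp hu) (D.abs_mul_le u)).add D.h_cont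

theorem abs_rhs_mul_le (u : EuclideanSpace ℝ (Fin N) → ℝ) (x : EuclideanSpace ℝ (Fin N)) :
    |convRho ρ J (fun y => f (u y)) x + h x| * ρ x ≤ bound ρ J M H * ρ.supNorm :=
  mul_le_mul (D.abs_rhs_le u x) (ρ.le_supNorm x) (ρ.pos x).le D.bound_nonneg

theorem abs_convRho_sub_le {u v : EuclideanSpace ℝ (Fin N) → ℝ} (hu : Continuous u)
    (hv : Continuous v) {A : ℝ}
    (hA : ∀ y, |u y - v y| * ρ y ≤ A) (x : EuclideanSpace ℝ (Fin N)) :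
    |convRho ρ J (fun y => f (u y)) x - convRho ρ J (fun y => f (v y)) x|
      ≤ (∫ y, J y) * (k * A) := by
  rw [convRho_sub (p := fun y => f (u y)) (q :=
      fun y => f (v y)) D.J_int (D.f_diff.continuous.comp hu).measurable
    (D.f_diff.continuous.comp hv).measurable (D.abs_mul_le u) (D.abs_mul_le v)]
  refine abs_convRho_le D.J_nonneg D.J_int (fun y => ?_) x
  have := D.f_lip.dist_le_mul (u y) (v y)
  rw [Real.dist_eq, Real.dist_eq] at this
  calc |f (u y) - f (v y)| * ρ y ≤ k * |u y - v y| * ρ y :=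
        mul_le_mul_of_nonneg_right this (ρ.pos y).le
    _ = k * (|u y - v y| * ρ y) := by ring
    _ ≤ k * A := mul_le_mul_of_nonneg_left (hA y) k.2

end

/-- The bounded part `u ↦ J *_ρ (f ∘ u) + h` of the vector field. -/
noncomputable def nonlin (D : IsFieldData J f h k M H) (u : CRho ρ) : CRho ρ :=
  CRho.mk _ (D.continuous_rhs u.continuous) _ (D.abs_rhs_mul_le u)

variable (D : IsFieldData J f h k M H)

theorem nonlin_apply (u : CRho ρ) (x : EuclideanSpace ℝ (Fin N)) :
    D.nonlin u x = convRho ρ J (fun y => f (u y)) x + h x := rfl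

theorem norm_nonlin_le (u : CRho ρ) : ‖D.nonlin u‖ ≤ bound ρ J M H * ρ.supNorm :=
  CRho.norm_le_of_forall (D.abs_rhs_mul_le u)

theorem lipschitzWith_nonlin :
    LipschitzWith (Real.toNNReal ((∫ y, J y) * k * ρ.supNorm)) (D.nonlin (ρ := ρ)) := by
  refine LipschitzWith.of_dist_le_mul fun u v => ?_
  have h0 : 0 ≤ (∫ y, J y) * k * ρ.supNorm :=
    mul_nonneg (mul_nonneg D.integral_J_nonneg k.2) ρ.supNorm_nonneg
  rw [Real.coe_toNNReal _ h0, dist_eq_norm, dist_eq_norm]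
  refine CRho.norm_le_of_forall fun x => ?_
  have h1 := D.abs_convRho_sub_le (ρ := ρ) u.continuous v.continuous (A := ‖u - v‖)
    (fun y => by simpa [CRho.norm_def] using (u - v).le_rhoNorm y) x
  rw [CRho.sub_apply, nonlin_apply, nonlin_apply, add_sub_add_right_eq_sub]
  calc _ ≤ ((∫ y, J y) * (k * ‖u - v‖)) * ρ.supNorm :=
        mul_le_mul h1 (ρ.le_supNorm x) (ρ.pos x).le
          (mul_nonneg D.integral_J_nonneg (mul_nonneg k.2 (norm_nonneg _)))
    _ = _ := by ring

theorem isSolution_iff (u : ℝ → CRho ρ) :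
    IsSolution ρ J f h u ↔ ∀ t, HasDerivAt u (-u t + D.nonlin (u t)) t := by
  refine forall_congr' fun t => ⟨?_, fun hd => ⟨_, fun x => ?_, hd⟩⟩
  · rintro ⟨w, hw, hd⟩
    convert hd using 1
    ext x
    rw [hw, CRho.add_apply, CRho.neg_apply, nonlin_apply, add_assoc]
  · rw [CRho.add_apply, CRho.neg_apply, nonlin_apply, add_assoc]

theorem exists_flowOfEquation (D : IsFieldData J f h k M H) :
    ∃ T : Flow ℝ (CRho ρ), IsFlowOfEquation ρ J f h T := by
  obtain ⟨T, hT⟩ := exists_flow (D.lipschitzWith_nonlin (ρ := ρ)) D.norm_nonlin_le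
  exact ⟨T, fun u => (D.isSolution_iff u).trans (hT u)⟩

end IsFieldData

end WeightedSpace

/-! ### The energy and its derivative. -/

section Lyapunov

open Set Topology NNReal

/-- Applied with m = ρ and m = `pairKernel`: integrability comes from the weight alone, so uniform
bounds on the other factor suffice. The open set S allows for bounds that hold only for positive
times. -/
theorem hasDerivAt_integral_mul_of_bounded {α : Type*} [MeasurableSpace α] {ν : Measure α}
    {m : α → ℝ} (hm : Integrable m ν) {a a' : ℝ → α → ℝ} {S : Set ℝ} (hS : IsOpen S)
    {c c' : ℝ} (ha : ∀ t, Measurable (a t)) (ha' : ∀ t, Measurable (a' t))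
    (hc : ∀ t ∈ S, ∀ z, |a t z| ≤ c) (hc' : ∀ t ∈ S, ∀ z, |a' t z| ≤ c')
    (hd : ∀ t ∈ S, ∀ z, HasDerivAt (fun s => a s z) (a' t z) t) {t : ℝ} (ht : t ∈ S) :
    HasDerivAt (fun s => ∫ z, m z * a s z ∂ν) (∫ z, m z * a' t z ∂ν) t := by
  refine (hasDerivAt_integral_of_dominated_loc_of_deriv_le (F := fun s z => m z * a s z)
    (F' := fun s z => m z * a' s z) (bound := fun z => |m z| * c') (hS.mem_nhds ht)
    (Eventually.of_forall fun s => hm.aestronglyMeasurable.mul (ha s).aestronglyMeasurable)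
    (hm.mul_bdd (ha t).aestronglyMeasurable (ae_of_all _ (hc t ht)))
    (hm.aestronglyMeasurable.mul (ha' t).aestronglyMeasurable)
    (ae_of_all _ fun z s hs => ?_) (hm.abs.mul_const c')
    (ae_of_all _ fun z s hs => (hd s hs z).const_mul (m z))).2
  rw [norm_mul, Real.norm_eq_abs, Real.norm_eq_abs]
  exact mul_le_mul_of_nonneg_left (hc' s hs z) (abs_nonneg _)

theorem tendsto_integral_mul_of_bounded {α ι : Type*} [MeasurableSpace α] {ν : Measure α}
    {m : α → ℝ} (hm : Integrable m ν) {l : Filter ι} [l.IsCountablyGenerated] {a : ι → α → ℝ}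
    {b : α → ℝ} {c : ℝ} (ha : ∀ i, Measurable (a i)) (hc : ∀ᶠ i in l, ∀ z, |a i z| ≤ c)
    (hab : ∀ z, Tendsto (fun i => a i z) l (𝓝 (b z))) :
    Tendsto (fun i => ∫ z, m z * a i z ∂ν) l (𝓝 (∫ z, m z * b z ∂ν)) := by
  refine tendsto_integral_filter_of_dominated_convergence (fun z => |m z| * c)
    (Eventually.of_forall fun i => hm.aestronglyMeasurable.mul (ha i).aestronglyMeasurable)
    (hc.mono fun i hi => ae_of_all _ fun z => ?_) (hm.abs.mul_const c)
    (ae_of_all _ fun z => (hab z).const_mul _)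
  rw [norm_mul, Real.norm_eq_abs, Real.norm_eq_abs]
  exact mul_le_mul_of_nonneg_left (hi z) (abs_nonneg _)

theorem abs_integral_mul_le_of_bounded {α : Type*} [MeasurableSpace α] {ν : Measure α}
    {m : α → ℝ} (hm : Integrable m ν) {a : α → ℝ} {c : ℝ} (hc : ∀ z, |a z| ≤ c) :
    |∫ z, m z * a z ∂ν| ≤ (∫ z, |m z| ∂ν) * c := by
  rw [← integral_mul_const, ← Real.norm_eq_abs]
  refine norm_integral_le_of_norm_le (hm.abs.mul_const c) (ae_of_all _ fun z => ?_)
  rw [norm_mul, Real.norm_eq_abs, Real.norm_eq_abs]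
  exact mul_le_mul_of_nonneg_left (hc z) (abs_nonneg _)

/-- `s f(s) - ∫₀ˢ f`, a primitive of `s f'(s)`. -/
noncomputable def legendre (f : ℝ → ℝ) (s : ℝ) : ℝ := s * f s - ∫ τ in (0 : ℝ)..s, f τ

theorem hasDerivAt_legendre {f : ℝ → ℝ} (hf : Differentiable ℝ f) (s : ℝ) :
    HasDerivAt (legendre f) (s * deriv f s) s := by
  have h1 := (hasDerivAt_id s).mul (hf s).hasDerivAt
  have h2 := hf.continuous.integral_hasStrictDerivAt 0 s
  refine (h1.sub h2.hasDerivAt).congr_deriv ?_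
  simp

theorem continuous_legendre {f : ℝ → ℝ} (hf : Differentiable ℝ f) : Continuous (legendre f) :=
  continuous_iff_continuousAt.2 fun s => (hasDerivAt_legendre hf s).continuousAt

theorem abs_legendre_le {f : ℝ → ℝ} {M : ℝ} (hM : ∀ s, |f s| ≤ M) {s G : ℝ} (hs : |s| ≤ G) :
    |legendre f s| ≤ 2 * M * G := by
  have hM0 : 0 ≤ M := (abs_nonneg _).trans (hM 0)
  have h1 : |∫ τ in (0 : ℝ)..s, f τ| ≤ M * |s - 0| := by
    rw [← Real.norm_eq_abs]
    exact intervalIntegral.norm_integral_le_of_norm_le_const fun τ _ => hM τ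
  have h2 : |s * f s| ≤ G * M := by
    rw [abs_mul]; exact mul_le_mul hs (hM s) (abs_nonneg _) ((abs_nonneg _).trans hs)
  have h3 : M * |s - 0| ≤ M * G := by rw [sub_zero]; exact mul_le_mul_of_nonneg_left hs hM0
  have := abs_sub (s * f s) (∫ τ in (0 : ℝ)..s, f τ)
  unfold legendre
  linarith

variable {N : ℕ}

/-- The symmetric kernel `J(x - y) ρ(x) ρ(y)`. -/
noncomputable def pairKernel (ρ : Weight N) (J : EuclideanSpace ℝ (Fin N) → ℝ)
    (z : EuclideanSpace ℝ (Fin N) × EuclideanSpace ℝ (Fin N)) : ℝ :=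
  J (z.1 - z.2) * ρ z.1 * ρ z.2

/-- The energy of a bounded function. -/
noncomputable def energy (ρ : Weight N) (J : EuclideanSpace ℝ (Fin N) → ℝ) (f : ℝ → ℝ)
    (h v : EuclideanSpace ℝ (Fin N) → ℝ) : ℝ :=
  (∫ x, ρ x * (legendre f (v x) - h x * f (v x))) -
    2⁻¹ * ∫ z, pairKernel ρ J z * (f (v z.1) * f (v z.2)) ∂(volume.prod volume)

variable {ρ : Weight N} {J : EuclideanSpace ℝ (Fin N) → ℝ}

theorem integrable_pairKernel (hJ : Integrable J) :
    Integrable (pairKernel ρ J) (volume.prod volume) := by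
  have h1 := ρ.integrable.convolution_integrand (ContinuousLinearMap.mul ℝ ℝ) hJ
  have h2 := h1.mul_bdd (g := fun z => ρ z.1) (c := ρ.supNorm)
    (ρ.continuous_toFun.comp continuous_fst).aestronglyMeasurable
    (ae_of_all _ fun z => by
      rw [Real.norm_of_nonneg (ρ.pos _).le]; exact ρ.le_supNorm _)
  refine h2.congr (ae_of_all _ fun z => ?_)
  simp only [pairKernel, ContinuousLinearMap.mul_apply']
  ring

theorem integral_pairKernel_mul (hJ : Integrable J) {a b : EuclideanSpace ℝ (Fin N) → ℝ}
    (ha : Measurable a) (hb : Measurable b) {A B : ℝ} (hA : ∀ x, |a x| ≤ A)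
    (hB : ∀ x, |b x| ≤ B) :
    ∫ z, pairKernel ρ J z * (a z.1 * b z.2) ∂(volume.prod volume) =
      ∫ x, ρ x * (a x * convRho ρ J b x) := by
  rw [integral_prod]
  · refine integral_congr_ae (ae_of_all _ fun x => ?_)
    simp only [pairKernel, convRho]
    rw [← integral_const_mul, ← integral_const_mul]
    congr 1
    ext y
    ring
  · refine (integrable_pairKernel hJ).mul_bdd (c := A * B)
      ((ha.comp measurable_fst).mul (hb.comp measurable_snd)).aestronglyMeasurable
      (ae_of_all _ fun z => ?_)
    rw [norm_mul]
    exact mul_le_mul (hA _) (hB _) (abs_nonneg _) ((abs_nonneg _).trans (hA 0))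

/-- Swapping the two variables fixes the kernel because J is even; evenness is used nowhere else. -/
theorem integral_pairKernel_mul_comm (hJ : ∀ x, J (-x) = J x)
    (a b : EuclideanSpace ℝ (Fin N) → ℝ) :
    ∫ z, pairKernel ρ J z * (a z.1 * b z.2) ∂(volume.prod volume) =
      ∫ z, pairKernel ρ J z * (b z.1 * a z.2) ∂(volume.prod volume) := by
  rw [← integral_prod_swap]
  refine integral_congr_ae (ae_of_all _ fun z => ?_)
  simp only [pairKernel, Prod.fst_swap, Prod.snd_swap]
  rw [← hJ (z.1 - z.2), neg_sub]
  ring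

namespace IsFieldData

variable {f : ℝ → ℝ} {h : EuclideanSpace ℝ (Fin N) → ℝ} {k : ℝ≥0} {M H : ℝ}

section

variable (D : IsFieldData J f h k M H)
include D

theorem abs_deriv_le (s : ℝ) : |deriv f s| ≤ k := norm_deriv_le_of_lipschitz D.f_lip

theorem deriv_nonneg (s : ℝ) : 0 ≤ deriv f s := D.f_mono.monotone.deriv_nonneg

theorem hasDerivAt_comp {v : ℝ → ℝ} {v' t : ℝ} (hv : HasDerivAt v v' t) :
    HasDerivAt (fun s => f (v s)) (deriv f (v t) * v') t :=
  (D.f_diff (v t)).hasDerivAt.comp t hv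

theorem abs_energy_le {v : EuclideanSpace ℝ (Fin N) → ℝ} {G : ℝ} (hv : ∀ x, |v x| ≤ G) :
    |energy ρ J f h v| ≤ (∫ x, |ρ x|) * (2 * M * G + H * M) +
      2⁻¹ * ((∫ z, |pairKernel ρ J z| ∂(volume.prod volume)) * (M * M)) := by
  have h1 := abs_integral_mul_le_of_bounded ρ.integrable
    (a := fun x => legendre f (v x) - h x * f (v x)) (c := 2 * M * G + H * M) fun x => by
      refine (abs_sub _ _).trans (add_le_add (abs_legendre_le D.f_le (hv x)) ?_)
      rw [abs_mul]
      exact mul_le_mul (D.h_le x) (D.f_le _) (abs_nonneg _) D.H_nonneg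
  have h2 := abs_integral_mul_le_of_bounded (integrable_pairKernel (ρ := ρ) D.J_int)
    (a := fun z => f (v z.1) * f (v z.2)) (c := M * M) fun z => by
      rw [abs_mul]
      exact mul_le_mul (D.f_le _) (D.f_le _) (abs_nonneg _) D.M_nonneg
  refine (abs_sub _ _).trans (add_le_add h1 ?_)
  rw [abs_mul, abs_of_pos (by norm_num : (0 : ℝ) < 2⁻¹)]
  exact mul_le_mul_of_nonneg_left h2 (by norm_num)

/-- Dominated convergence against ρ and `pairKernel`. Asking only for pointwise convergence under a
common bound is what makes compactness of orbits unnecessary. -/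
theorem tendsto_energy {ι : Type*} {l : Filter ι} [l.IsCountablyGenerated]
    {v : ι → EuclideanSpace ℝ (Fin N) → ℝ} {w : EuclideanSpace ℝ (Fin N) → ℝ}
    (hv : ∀ i, Continuous (v i)) {G : ℝ} (hG : ∀ᶠ i in l, ∀ x, |v i x| ≤ G)
    (hvw : ∀ x, Tendsto (fun i => v i x) l (𝓝 (w x))) :
    Tendsto (fun i => energy ρ J f h (v i)) l (𝓝 (energy ρ J f h w)) := by
  have hf := D.f_diff.continuous
  have hfv : ∀ x, Tendsto (fun i => f (v i x)) l (𝓝 (f (w x))) := fun x =>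
    (hf.tendsto _).comp (hvw x)
  refine Tendsto.sub (tendsto_integral_mul_of_bounded ρ.integrable
      (c := 2 * M * G + H * M) (fun i => ?_) (hG.mono fun i hi x => ?_) fun x => ?_)
    ((tendsto_integral_mul_of_bounded (integrable_pairKernel D.J_int) (c := M * M)
      (fun i => ?_) (Eventually.of_forall fun i z => ?_) fun z => ?_).const_mul _)
  · exact (((continuous_legendre D.f_diff).comp (hv i)).sub
      (D.h_cont.mul (hf.comp (hv i)))).measurable
  · refine (abs_sub _ _).trans (add_le_add (abs_legendre_le D.f_le (hi x)) ?_)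
    rw [abs_mul]
    exact mul_le_mul (D.h_le x) (D.f_le _) (abs_nonneg _) D.H_nonneg
  · exact (((continuous_legendre D.f_diff).tendsto _).comp (hvw x)).sub ((hfv x).const_mul _)
  · exact ((hf.comp ((hv i).comp continuous_fst)).mul
      (hf.comp ((hv i).comp continuous_snd))).measurable
  · rw [abs_mul]
    exact mul_le_mul (D.f_le _) (D.f_le _) (abs_nonneg _) D.M_nonneg
  · exact (hfv _).mul (hfv _)

variable {v v' : ℝ → EuclideanSpace ℝ (Fin N) → ℝ} {S : Set ℝ} {G G' t : ℝ}

/-- The derivative of s ↦ s f(s) - ∫₀ˢ f is s f'(s), which produces the term f'(v) v' v. In the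
double integral, the two terms of the product rule coincide by symmetry of the kernel. -/
theorem hasDerivAt_energy (hS : IsOpen S)
    (hv : ∀ t, Continuous (v t)) (hv' : ∀ t, Continuous (v' t))
    (hG : ∀ t ∈ S, ∀ x, |v t x| ≤ G) (hG' : ∀ t ∈ S, ∀ x, |v' t x| ≤ G')
    (hd : ∀ t ∈ S, ∀ x, HasDerivAt (fun s => v s x) (v' t x) t) (ht : t ∈ S) :
    HasDerivAt (fun s => energy ρ J f h (v s))
      (∫ x, ρ x * (deriv f (v t x) * v' t x *
        (v t x - (convRho ρ J (fun y => f (v t y)) x + h x)))) t := by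
  have hf := D.f_diff.continuous
  have hfv : ∀ t, Continuous fun x => f (v t x) := fun t => hf.comp (hv t)
  have hq_meas : ∀ t, Measurable fun x => deriv f (v t x) * v' t x := fun t =>
    ((measurable_deriv f).comp (hv t).measurable).mul (hv' t).measurable
  have hq : ∀ t ∈ S, ∀ x, |deriv f (v t x) * v' t x| ≤ k * G' := fun t ht x => by
    rw [abs_mul]
    exact mul_le_mul (D.abs_deriv_le _) (hG' t ht x) (abs_nonneg _) k.2
  have hkG' : 0 ≤ k * G' := (abs_nonneg _).trans (hq t ht 0)
  have h1 := hasDerivAt_integral_mul_of_bounded ρ.integrable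
    (a := fun s x => legendre f (v s x) - h x * f (v s x))
    (a' := fun s x => deriv f (v s x) * v' s x * (v s x - h x)) hS
    (c := 2 * M * G + H * M) (c' := k * G' * (G + H))
    (fun s => (((continuous_legendre D.f_diff).comp (hv s)).sub (D.h_cont.mul (hfv s))).measurable)
    (fun s => (hq_meas s).mul ((hv s).sub D.h_cont).measurable)
    (fun s hs x => by
      refine (abs_sub _ _).trans (add_le_add (abs_legendre_le D.f_le (hG s hs x)) ?_)
      rw [abs_mul]
      exact mul_le_mul (D.h_le x) (D.f_le _) (abs_nonneg _) D.H_nonneg)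
    (fun s hs x => by
      rw [abs_mul]
      exact mul_le_mul (hq s hs x)
        ((abs_sub _ _).trans (add_le_add (hG s hs x) (D.h_le x))) (abs_nonneg _) hkG')
    (fun s hs x => by
      refine (((hasDerivAt_legendre D.f_diff (v s x)).comp s (hd s hs x)).sub
        ((D.hasDerivAt_comp (hd s hs x)).const_mul (h x))).congr_deriv ?_
      ring) ht
  have h2 := hasDerivAt_integral_mul_of_bounded (integrable_pairKernel (ρ := ρ) D.J_int)
    (a := fun s z => f (v s z.1) * f (v s z.2))
    (a' := fun s z => (deriv f (v s z.1) * v' s z.1) * f (v s z.2) +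
      f (v s z.1) * (deriv f (v s z.2) * v' s z.2)) hS
    (c := M * M) (c' := k * G' * M + M * (k * G'))
    (fun s => (((hfv s).comp continuous_fst).mul ((hfv s).comp continuous_snd)).measurable)
    (fun s => (((hq_meas s).comp measurable_fst).mul ((hfv s).comp continuous_snd).measurable).add
      (((hfv s).comp continuous_fst).measurable.mul ((hq_meas s).comp measurable_snd)))
    (fun s hs z => by
      rw [abs_mul]
      exact mul_le_mul (D.f_le _) (D.f_le _) (abs_nonneg _) D.M_nonneg)
    (fun s hs z => by
      refine (abs_add_le _ _).trans (add_le_add ?_ ?_) <;> rw [abs_mul]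
      · exact mul_le_mul (hq s hs _) (D.f_le _) (abs_nonneg _) hkG'
      · exact mul_le_mul (D.f_le _) (hq s hs _) (abs_nonneg _) D.M_nonneg)
    (fun s hs z => (D.hasDerivAt_comp (hd s hs _)).mul (D.hasDerivAt_comp (hd s hs _))) ht
  refine (h1.sub (h2.const_mul 2⁻¹)).congr_deriv ?_
  have i1 : Integrable (fun z : EuclideanSpace ℝ (Fin N) × EuclideanSpace ℝ (Fin N) =>
      pairKernel ρ J z * ((deriv f (v t z.1) * v' t z.1) * f (v t z.2)))
      (volume.prod volume) := by
    refine (integrable_pairKernel D.J_int).mul_bdd (c := k * G' * M)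
      (((hq_meas t).comp measurable_fst).mul
        ((hfv t).comp continuous_snd).measurable).aestronglyMeasurable (ae_of_all _ fun z => ?_)
    rw [norm_mul]
    exact mul_le_mul (hq t ht _) (D.f_le _) (abs_nonneg _) hkG'
  have i2 : Integrable (fun z : EuclideanSpace ℝ (Fin N) × EuclideanSpace ℝ (Fin N) =>
      pairKernel ρ J z * (f (v t z.1) * (deriv f (v t z.2) * v' t z.2)))
      (volume.prod volume) := by
    refine (integrable_pairKernel D.J_int).mul_bdd (c := M * (k * G'))
      (((hfv t).comp continuous_fst).measurable.mul
        ((hq_meas t).comp measurable_snd)).aestronglyMeasurable (ae_of_all _ fun z => ?_)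
    rw [norm_mul]
    exact mul_le_mul (D.f_le _) (hq t ht _) (abs_nonneg _) D.M_nonneg
  simp_rw [mul_add]
  rw [integral_add i1 i2, integral_pairKernel_mul_comm D.J_even (fun x => f (v t x))
      (fun x => deriv f (v t x) * v' t x),
    integral_pairKernel_mul (b :=
    fun x => f (v t x)) D.J_int (hq_meas t) (hfv t).measurable (hq t ht) (fun x => D.f_le _)]
  -- The two equal terms cancel the factor ½.
  rw [← two_mul, inv_mul_cancel_left₀ two_ne_zero, ← integral_sub]
  · congr 1
    ext x
    ring
  · refine ρ.integrable.mul_bdd (c := k * G' * (G + H))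
      ((hq_meas t).mul ((hv t).sub D.h_cont).measurable).aestronglyMeasurable
      (ae_of_all _ fun x => ?_)
    rw [norm_mul]
    exact mul_le_mul (hq t ht x)
      ((abs_sub _ _).trans (add_le_add (hG t ht x) (D.h_le x))) (abs_nonneg _) hkG'
  · refine ρ.integrable.mul_bdd (c := k * G' * ((∫ y, J y) * (M * ρ.supNorm)))
      ((hq_meas t).mul (continuous_convRho D.J_int (hfv t)
        (D.abs_mul_le (v t))).measurable).aestronglyMeasurable (ae_of_all _ fun x => ?_)
    rw [norm_mul]
    exact mul_le_mul (hq t ht x)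
      (abs_convRho_le D.J_nonneg D.J_int (D.abs_mul_le (v t)) x) (abs_nonneg _) hkG'

end

end IsFieldData

end Lyapunov

/-! ### Limit points are equilibria. -/

section Limits

open Set Topology NNReal

/-- Variation of constants for `y' = -y + g` with `|g| ≤ G`. -/
theorem abs_sub_exp_mul_le {y g : ℝ → ℝ} {G : ℝ} (hy : ∀ t, HasDerivAt y (-y t + g t) t)
    (hg : ∀ t, |g t| ≤ G) {s t : ℝ} (hst : s ≤ t) :
    |y t - Real.exp (-(t - s)) * y s| ≤ G := by
  have upper : ∀ {y g : ℝ → ℝ}, (∀ t, HasDerivAt y (-y t + g t) t) → (∀ t, |g t| ≤ G) →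
      y t - Real.exp (-(t - s)) * y s ≤ G := by
    intro y g hy hg
    -- Since g ≤ G, e^r (y - G) is nonincreasing; comparing its values at s and t gives the upper
    -- bound. The lower one follows by replacing y and g with -y and -g.
    have hd : ∀ r, HasDerivAt (fun r => Real.exp r * (y r - G)) (Real.exp r * (g r - G)) r :=
      fun r => ((Real.hasDerivAt_exp r).mul ((hy r).sub_const G)).congr_deriv (by ring)
    have hanti : Antitone fun r => Real.exp r * (y r - G) :=
      antitone_of_hasDerivAt_nonpos hd fun r =>
        mul_nonpos_of_nonneg_of_nonpos (Real.exp_pos r).le (by linarith [le_abs_self (g r), hg r])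
    have h1 := hanti hst
    have hG : 0 ≤ G := (abs_nonneg _).trans (hg 0)
    have h2 : Real.exp t * (y t - Real.exp (-(t - s)) * y s) ≤ Real.exp t * G := by
      have e : Real.exp t * Real.exp (-(t - s)) = Real.exp s := by rw [← Real.exp_add]; ring_nf
      have := mul_nonneg (Real.exp_pos s).le hG
      dsimp only at h1
      rw [mul_sub, ← mul_assoc, e]
      linarith
    exact le_of_mul_le_mul_left h2 (Real.exp_pos t)
  have h1 := upper hy hg
  have h2 := upper (y := fun t => -y t) (g := fun t => -g t)
    (fun t => (hy t).neg.congr_deriv (by ring)) (fun t => by rw [abs_neg]; exact hg t)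
  rw [abs_le]
  constructor <;> linarith

namespace IsFieldData

variable {N : ℕ} {ρ : Weight N} {J : EuclideanSpace ℝ (Fin N) → ℝ}
variable {f : ℝ → ℝ} {h : EuclideanSpace ℝ (Fin N) → ℝ} {k : ℝ≥0} {M H : ℝ}

section

variable (D : IsFieldData J f h k M H)
include D

theorem integrable_dissipation {v v' : EuclideanSpace ℝ (Fin N) → ℝ} (hv : Continuous v)
    (hv' : Continuous v') {G G' : ℝ} (hG : ∀ x, |v x| ≤ G) (hG' : ∀ x, |v' x| ≤ G') :
    Integrable fun x => ρ x * (deriv f (v x) * v' x *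
      (v x - (convRho ρ J (fun y => f (v y)) x + h x))) := by
  have hq : ∀ x, |deriv f (v x) * v' x| ≤ k * G' := fun x => by
    rw [abs_mul]
    exact mul_le_mul (D.abs_deriv_le _) (hG' x) (abs_nonneg _) k.2
  refine ρ.integrable.mul_bdd (c := k * G' * (G + bound ρ J M H))
    ((((measurable_deriv f).comp hv.measurable).mul hv'.measurable).mul
      (hv.sub (D.continuous_rhs hv)).measurable).aestronglyMeasurable (ae_of_all _ fun x => ?_)
  rw [norm_mul]
  exact mul_le_mul (hq x) ((abs_sub _ _).trans (add_le_add (hG x) (D.abs_rhs_le v x)))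
    (abs_nonneg _) ((abs_nonneg _).trans (hq x))

/-- The energy production is bounded by the size of the perturbation `r`. -/
theorem dissipation_le {v v' r : EuclideanSpace ℝ (Fin N) → ℝ} (hv : Continuous v)
    (hv' : Continuous v') (hr : Continuous r) {G G' ε : ℝ} (hG : ∀ x, |v x| ≤ G)
    (hG' : ∀ x, |v' x| ≤ G') (hε : ∀ x, |r x| * ρ x ≤ ε)
    (hvv' : ∀ x, v' x = -v x + (convRho ρ J (fun y => f (v y + r y)) x + h x)) :
    ∫ x, ρ x * (deriv f (v x) * v' x * (v x - (convRho ρ J (fun y => f (v y)) x + h x))) ≤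
      (∫ x, ρ x) * (k * G' * ((∫ y, J y) * (k * ε))) := by
  rw [← integral_mul_const]
  refine integral_mono (D.integrable_dissipation hv hv' hG hG') (ρ.integrable.mul_const _)
    fun x => mul_le_mul_of_nonneg_left ?_ (ρ.pos x).le
  have h1 := D.abs_convRho_sub_le (ρ := ρ) (hv.add hr) hv (A := ε)
    (fun y => by rw [Pi.add_apply, add_sub_cancel_left]; exact hε y) x
  have hq : |deriv f (v x) * v' x| ≤ k * G' := by
    rw [abs_mul]
    exact mul_le_mul (D.abs_deriv_le _) (hG' x) (abs_nonneg _) k.2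
  set e := convRho ρ J (fun y => f ((v + r) y)) x - convRho ρ J (fun y => f (v y)) x with he
  -- The integrand splits into -f'(v) v'² ≤ 0 and f'(v) v' e, where e is the effect of r on the
  -- convolution.
  have h2 : v x - (convRho ρ J (fun y => f (v y)) x + h x) = -v' x + e := by
    rw [he, hvv' x]
    simp only [Pi.add_apply]
    ring
  have h3 : 0 ≤ deriv f (v x) * (v' x * v' x) := mul_nonneg (D.deriv_nonneg _) (mul_self_nonneg _)
  have h4 : deriv f (v x) * v' x * e ≤ k * G' * ((∫ y, J y) * (k * ε)) := by
    refine (le_abs_self _).trans ?_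
    rw [abs_mul]
    exact mul_le_mul hq h1 (abs_nonneg _) ((abs_nonneg _).trans hq)
  rw [h2]
  linarith [mul_add (deriv f (v x) * v' x) (-v' x) e,
    (by ring : deriv f (v x) * v' x * -v' x = -(deriv f (v x) * (v' x * v' x)))]

variable {T : Flow ℝ (CRho ρ)} (hT : IsFlowOfEquation ρ J f h T)
include hT

omit D in
theorem hasDerivAt_flow_apply (u : CRho ρ) (x : EuclideanSpace ℝ (Fin N)) (t : ℝ) :
    HasDerivAt (fun s => T s u x)
      (-T t u x + (convRho ρ J (fun y => f (T t u y)) x + h x)) t := by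
  have h1 : IsSolution ρ J f h fun t => T t u := (hT _).2 fun t => by rw [T.map_zero_apply]
  obtain ⟨w, hw, hd⟩ := h1 t
  have := CRho.hasDerivAt_apply hd x
  rwa [hw x, add_assoc] at this

/-- The nonlinear part of the field is bounded uniformly in u and x, and only e^{-(t-s)} T(s)u
remembers the possibly unbounded datum. -/
theorem abs_flow_sub_le (u : CRho ρ) (x : EuclideanSpace ℝ (Fin N)) {s t : ℝ} (hst : s ≤ t) :
    |T t u x - Real.exp (-(t - s)) * T s u x| ≤ bound ρ J M H :=
  abs_sub_exp_mul_le (hasDerivAt_flow_apply hT u x) (fun _ => D.abs_rhs_le _ x) hst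

/-- Along an orbit, the energy of `T(t) u - e^{-t} z` decreases up to an exponentially small
error. -/
theorem antitoneOn_energy (u z : CRho ρ) {S : Set ℝ} (hS : IsOpen S) (hSc : Convex ℝ S)
    (hG : ∀ t ∈ S, ∀ x, |T t u x - Real.exp (-t) * z x| ≤ bound ρ J M H) :
    AntitoneOn (fun t => energy ρ J f h (fun x => T t u x - Real.exp (-t) * z x) +
      (∫ x, ρ x) * (k * (bound ρ J M H + bound ρ J M H) * ((∫ y, J y) * (k * ‖z‖))) *
        Real.exp (-t)) S := by
  -- As e^{-t} z solves y' = -y, the difference v satisfies `dissipation_le` with r = e^{-t} z and ε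
  -- = e^{-t} ‖z‖. The energy then grows at rate at most C e^{-t}, which the derivative of C e^{-t}
  -- cancels.
  set C := (∫ x, ρ x) * (k * (bound ρ J M H + bound ρ J M H) * ((∫ y, J y) * (k * ‖z‖)))
  have hv : ∀ t, Continuous fun x => T t u x - Real.exp (-t) * z x := fun t =>
    (T t u).continuous.sub (continuous_const.mul z.continuous)
  have hv' : ∀ t, Continuous fun x => -(T t u x - Real.exp (-t) * z x) +
      (convRho ρ J (fun y => f (T t u y)) x + h x) := fun t =>
    (hv t).neg.add (D.continuous_rhs (T t u).continuous)
  have hG' : ∀ t ∈ S, ∀ x, |-(T t u x - Real.exp (-t) * z x) +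
      (convRho ρ J (fun y => f (T t u y)) x + h x)| ≤ bound ρ J M H + bound ρ J M H :=
    fun t ht x => (abs_add_le _ _).trans
      (add_le_add ((abs_neg _).trans_le (hG t ht x)) (D.abs_rhs_le _ x))
  have hexp : ∀ t : ℝ, HasDerivAt (fun t : ℝ => Real.exp (-t)) (-Real.exp (-t)) t := fun t => by
    simpa using (hasDerivAt_neg t).exp
  have hd := fun t (ht : t ∈ S) => (D.hasDerivAt_energy (ρ := ρ) hS hv hv' hG hG'
    (fun t _ x => ((hasDerivAt_flow_apply hT u x t).sub
      ((hexp t).mul_const (z x))).congr_deriv (by ring)) ht).add ((hexp t).const_mul C)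
  refine antitoneOn_of_hasDerivWithinAt_nonpos hSc
    (fun t ht => (hd t ht).continuousAt.continuousWithinAt)
    (fun t ht => (hd t (interior_subset ht)).hasDerivWithinAt) fun t ht => ?_
  have ht' := interior_subset ht
  have hε : ∀ x, |Real.exp (-t) * z x| * ρ x ≤ Real.exp (-t) * ‖z‖ := fun x => by
    rw [abs_mul, Real.abs_exp, mul_assoc]
    exact mul_le_mul_of_nonneg_left (z.le_rhoNorm x) (Real.exp_pos _).le
  have h1 := D.dissipation_le (ρ := ρ) (hv t) (hv' t)
    (continuous_const.mul z.continuous) (hG t ht') (hG' t ht') hε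
    (fun x => congrArg (fun p => -(T t u x - Real.exp (-t) * z x) + (convRho ρ J p x + h x))
      (funext fun y => congrArg f (sub_add_cancel (T t u y) (Real.exp (-t) * z y)).symm))
  have h2 : (∫ x, ρ x) * (k * (bound ρ J M H + bound ρ J M H) *
      ((∫ y, J y) * (k * (Real.exp (-t) * ‖z‖)))) = C * Real.exp (-t) := by
    simp only [C]; ring
  rw [h2] at h1
  linarith

/-- A bounded orbit of constant energy is an equilibrium. -/
theorem eq_rhs_of_energy_const {w : CRho ρ} {G l : ℝ} (hG : ∀ t x, |T t w x| ≤ G)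
    (hl : ∀ t, energy ρ J f h (T t w) = l) (x : EuclideanSpace ℝ (Fin N)) :
    w x = convRho ρ J (fun y => f (w y)) x + h x := by
  have hf := D.f_diff.continuous
  set v' : ℝ → EuclideanSpace ℝ (Fin N) → ℝ := fun t x =>
    -T t w x + (convRho ρ J (fun y => f (T t w y)) x + h x)
  have hd : ∀ t x, HasDerivAt (fun s => T s w x) (v' t x) t := fun t x =>
    hasDerivAt_flow_apply hT w x t
  have hv : ∀ t, Continuous (T t w) := fun t => (T t w).continuous
  have hv' : ∀ t, Continuous (v' t) := fun t => (hv t).neg.add (D.continuous_rhs (hv t))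
  have hG' : ∀ t x, |v' t x| ≤ G + bound ρ J M H := fun t x =>
    (abs_add_le _ _).trans (add_le_add ((abs_neg _).trans_le (hG t x)) (D.abs_rhs_le _ x))
  -- Along an actual orbit the dissipation is -∫ ρ f'(w) (∂_t w)², and constant energy forces it to
  -- vanish. Where f' = 0 this says nothing about ∂_t w, so only the product is controlled.
  have hq0 : ∀ t, (fun x => deriv f (T t w x) * v' t x) =ᵐ[volume] 0 := by
    intro t
    have h1 := D.hasDerivAt_energy (ρ := ρ) isOpen_univ hv hv' (fun t _ => hG t) (fun t _ => hG' t)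
      (fun t _ => hd t) (mem_univ t)
    simp_rw [hl] at h1
    have h2 := h1.unique (hasDerivAt_const t l)
    have hint := D.integrable_dissipation (ρ := ρ) (hv t) (hv' t) (hG t) (hG' t)
    have e : ∀ x, ρ x * (deriv f (T t w x) * v' t x *
        (T t w x - (convRho ρ J (fun y => f (T t w y)) x + h x))) =
        -(ρ x * (deriv f (T t w x) * (v' t x * v' t x))) := fun x => by simp only [v']; ring
    simp_rw [e] at h2 hint
    rw [integral_neg, neg_eq_zero] at h2
    rw [integral_eq_zero_iff_of_nonneg (fun x => mul_nonneg (ρ.pos x).le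
      (mul_nonneg (D.deriv_nonneg _) (mul_self_nonneg _))) (by simpa using hint.neg)] at h2
    filter_upwards [h2] with x hx
    have := (mul_eq_zero.1 hx).resolve_left (ρ.pos x).ne'
    rw [← mul_assoc] at this
    rcases mul_eq_zero.1 this with h3 | h3
    · exact h3
    · simp [h3]
  -- The product in `hq0` is ∂_t f(T(t)w). It vanishes almost everywhere for each fixed t, with an
  -- exceptional set depending on t, so the argument goes through an integral rather than point by
  -- point.
  have hconst : ∀ t, ∫ x, ρ x * (f (T t w x) - f (w x)) ^ 2 = 0 := by
    have hder : ∀ t, HasDerivAt (fun s => ∫ x, ρ x * (f (T s w x) - f (w x)) ^ 2) 0 t := by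
      intro t
      have hb : ∀ t x, |f (T t w x) - f (w x)| ≤ M + M := fun t x =>
        (abs_sub _ _).trans (add_le_add (D.f_le _) (D.f_le _))
      have h1 := hasDerivAt_integral_mul_of_bounded ρ.integrable
        (a := fun s x => (f (T s w x) - f (w x)) ^ 2)
        (a' := fun s x => 2 * (f (T s w x) - f (w x)) * (deriv f (T s w x) * v' s x))
        isOpen_univ (c := (M + M) ^ 2) (c' := 2 * (M + M) * (k * (G + bound ρ J M H)))
        (fun s => (((hf.comp (hv s)).sub (hf.comp w.continuous)).pow 2).measurable)
        (fun s => (continuous_const.mul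
          ((hf.comp (hv s)).sub (hf.comp w.continuous))).measurable.mul
          (((measurable_deriv f).comp (hv s).measurable).mul (hv' s).measurable))
        (fun s _ x => by
          rw [abs_pow]; exact pow_le_pow_left₀ (abs_nonneg _) (hb s x) 2)
        (fun s _ x => by
          rw [abs_mul, abs_mul, abs_mul, abs_two]
          have := D.M_nonneg
          exact mul_le_mul (mul_le_mul_of_nonneg_left (hb s x) zero_le_two)
            (mul_le_mul (D.abs_deriv_le _) (hG' s x) (abs_nonneg _) k.2)
            (mul_nonneg (abs_nonneg _) (abs_nonneg _)) (by positivity))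
        (fun s _ x => (((D.hasDerivAt_comp (hd s x)).sub_const (f (w x))).pow 2).congr_deriv
          (by norm_num)) (mem_univ t)
      refine h1.congr_deriv (integral_eq_zero_of_ae ?_)
      filter_upwards [hq0 t] with x hx
      rw [hx]
      simp
    intro t
    have := is_const_of_deriv_eq_zero (fun t => (hder t).differentiableAt)
      (fun t => (hder t).deriv) t 0
    rw [this]
    simp [T.map_zero_apply]
  have hTw : ∀ t, T t w x = w x := by
    intro t
    have h1 := hconst t
    have hsq : Continuous fun x => (f (T t w x) - f (w x)) ^ 2 :=
      ((hf.comp (hv t)).sub (hf.comp w.continuous)).pow 2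
    -- Continuity upgrades vanishing almost everywhere to vanishing everywhere.
    have hc : Continuous fun x => ρ x * (f (T t w x) - f (w x)) ^ 2 :=
      ρ.continuous_toFun.mul hsq
    rw [integral_eq_zero_iff_of_nonneg (fun x => mul_nonneg (ρ.pos x).le (sq_nonneg _))
      (ρ.integrable.mul_bdd (c := (M + M) ^ 2)
        hsq.aestronglyMeasurable
        (ae_of_all _ fun x => by
          rw [norm_pow]
          exact pow_le_pow_left₀ (norm_nonneg _)
            ((abs_sub _ _).trans (add_le_add (D.f_le _) (D.f_le _))) 2)),
      hc.ae_eq_iff_eq volume continuous_zero] at h1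
    have h2 := (mul_eq_zero.1 (congrFun h1 x)).resolve_left (ρ.pos x).ne'
    exact D.f_mono.injective (sub_eq_zero.1 (pow_eq_zero_iff two_ne_zero |>.1 h2))
  have h1 := hd 0 x
  simp_rw [hTw] at h1
  have h2 := h1.unique (hasDerivAt_const 0 (w x))
  simp only [v', T.map_zero_apply] at h2
  linarith

/-- LaSalle's principle for orbits `T(t) u` that are asymptotic, pointwise, to a bounded curve
along which the energy converges. -/
theorem eq_rhs_of_tendsto {u w : CRho ρ} {v : ℝ → EuclideanSpace ℝ (Fin N) → ℝ} {F : Filter ℝ}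
    {τ : ℕ → ℝ} (hτ : ∀ s, Tendsto (fun n => s + τ n) atTop F)
    (hw : Tendsto (fun n => T (τ n) u) atTop (𝓝 w)) (hv : ∀ t, Continuous (v t)) {G l : ℝ}
    (hG : ∀ᶠ t in F, ∀ x, |v t x| ≤ G)
    (hvT : ∀ x, Tendsto (fun t => v t x - T t u x) F (𝓝 0))
    (hl : Tendsto (fun t => energy ρ J f h (v t)) F (𝓝 l)) (x : EuclideanSpace ℝ (Fin N)) :
    w x = convRho ρ J (fun y => f (w y)) x + h x := by
  have hlim : ∀ s x, Tendsto (fun n => v (s + τ n) x) atTop (𝓝 (T s w x)) := by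
    intro s x
    -- T(s + τ_n)u = T(s)T(τ_n)u, and T(s) is continuous.
    have h1 : Tendsto (fun n => T (s + τ n) u) atTop (𝓝 (T s w)) := by
      simp_rw [T.map_add]
      exact ((T.continuous_toFun s).tendsto w).comp hw
    simpa using ((hvT x).comp (hτ s)).add (CRho.tendsto_apply h1 x)
  refine D.eq_rhs_of_energy_const hT (G := G) (l := l) (fun s x => ?_) (fun s => ?_) x
  · exact le_of_tendsto (hlim s x).abs (((hτ s).eventually hG).mono fun n hn => hn x)
  · exact tendsto_nhds_unique
      (D.tendsto_energy (fun n => hv (s + τ n)) ((hτ s).eventually hG) (hlim s))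
      (hl.comp (hτ s))

theorem eq_rhs_of_mem_omegaLimit_atTop {u w : CRho ρ} (hw : w ∈ omegaLimit atTop T {u})
    (x : EuclideanSpace ℝ (Fin N)) : w x = convRho ρ J (fun y => f (w y)) x + h x := by
  obtain ⟨τ, hτw, hτ⟩ :=
      ((mem_omegaLimit_singleton_iff_mapClusterPt _ _ _ _).1 hw).exists_seq_tendsto
  have hG : ∀ t ∈ Ioi (0 : ℝ), ∀ x, |T t u x - Real.exp (-t) * u x| ≤ bound ρ J M H :=
    fun t ht x => by simpa [T.map_zero_apply] using D.abs_flow_sub_le hT u x (le_of_lt ht)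
  have hexp : Tendsto (fun t : ℝ => Real.exp (-t)) atTop (𝓝 0) :=
    Real.tendsto_exp_neg_atTop_nhds_zero
  have hanti := D.antitoneOn_energy hT u u isOpen_Ioi (convex_Ioi 0) hG
  set C := (∫ x, ρ x) * (k * (bound ρ J M H + bound ρ J M H) * ((∫ y, J y) * (k * ‖u‖)))
  set ψ : ℝ → ℝ := fun t => energy ρ J f h (fun x => T t u x - Real.exp (-t) * u x) +
    C * Real.exp (-t)
  have hC : 0 ≤ C := by
    have := D.bound_nonneg (ρ := ρ)
    have := D.integral_J_nonneg
    have : 0 ≤ ∫ x, ρ x := integral_nonneg fun x => (ρ.pos x).le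
    positivity
  have hψ : ∃ l, Tendsto ψ atTop (𝓝 l) := by
    have hpos : ∀ t : ℝ, max t 1 ∈ Ioi (0 : ℝ) := fun t =>
      mem_Ioi.2 (lt_max_of_lt_right one_pos)
    -- Monotonicity is known only for t > 0; freezing ψ for t ≤ 1 makes it monotone on ℝ.
    have h1 : Antitone fun t => ψ (max t 1) := fun a b hab =>
      hanti (hpos a) (hpos b) (max_le_max_right 1 hab)
    have h2 : BddBelow (range fun t => ψ (max t 1)) :=
      ⟨_, forall_mem_range.2 fun t =>
        (neg_le_of_abs_le (D.abs_energy_le (ρ := ρ) (hG (max t 1) (hpos t)))).trans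
          (le_add_of_nonneg_right (mul_nonneg hC (Real.exp_pos _).le))⟩
    refine ⟨_, (tendsto_atTop_ciInf h1 h2).congr' ?_⟩
    filter_upwards [eventually_ge_atTop 1] with t ht
    rw [max_eq_left ht]
  obtain ⟨l, hl⟩ := hψ
  refine D.eq_rhs_of_tendsto hT (v := fun t x => T t u x - Real.exp (-t) * u x) (l := l)
    (fun s => tendsto_atTop_add_const_left _ s hτ) hτw
    (fun t => (T t u).continuous.sub (continuous_const.mul u.continuous))
    ((eventually_gt_atTop 0).mono hG) (fun x => ?_) ?_ x
  · simpa using (hexp.mul_const (u x)).neg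
  · simpa [ψ] using hl.sub (hexp.const_mul C)

theorem eq_rhs_of_mem_omegaLimit_atBot {u w : CRho ρ} (hw : w ∈ omegaLimit atBot T {u})
    (x : EuclideanSpace ℝ (Fin N)) : w x = convRho ρ J (fun y => f (w y)) x + h x := by
  obtain ⟨τ, hτw, hτ⟩ :=
      ((mem_omegaLimit_singleton_iff_mapClusterPt _ _ _ _).1 hw).exists_seq_tendsto
  -- In `abs_flow_sub_le` let s = τ_n → -∞: T(τ_n)u(x) converges and the exponential tends to 0.
  have hG : ∀ t x, |T t u x| ≤ bound ρ J M H := by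
    intro t x
    have h1 : Tendsto (fun n => Real.exp (-(t - τ n))) atTop (𝓝 0) := by
      refine Real.tendsto_exp_atBot.comp ?_
      simp_rw [neg_sub, sub_eq_add_neg]
      exact tendsto_atBot_add_const_right _ _ hτ
    have h2 : Tendsto (fun n => T t u x - Real.exp (-(t - τ n)) * T (τ n) u x) atTop
        (𝓝 (T t u x)) := by
      simpa using (h1.mul (CRho.tendsto_apply hτw x)).const_sub (T t u x)
    exact le_of_tendsto h2.abs
      ((hτ.eventually (eventually_le_atBot t)).mono fun n hn => D.abs_flow_sub_le hT u x hn)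
  -- For z = 0 the error constant is zero, so the energy itself decreases.
  have hanti : Antitone fun t => energy ρ J f h (T t u) := by
    simpa [antitoneOn_univ] using D.antitoneOn_energy hT u 0 isOpen_univ convex_univ
      (fun t _ x => by simpa using hG t x)
  have hbdd : BddAbove (range fun t => energy ρ J f h (T t u)) :=
    ⟨_, forall_mem_range.2 fun t => (le_abs_self _).trans (D.abs_energy_le (ρ := ρ) (hG t))⟩
  exact D.eq_rhs_of_tendsto hT (v := fun t => T t u) (fun s => tendsto_atBot_add_const_left _ s hτ)
    hτw (fun t => (T t u).continuous) (Eventually.of_forall hG) (fun x => by simp)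
    (tendsto_atBot_ciSup hanti hbdd) x

end

end IsFieldData

end Limits

/-! ### The radius of the ball, and the conclusion. -/

theorem slope_nonneg_of_abs_le {f : ℝ → ℝ} {η K : ℝ} (hf : ∀ s, |f s| ≤ η * |s| + K) : 0 ≤ η := by
  by_contra! hη
  have hK : 0 ≤ K := by simpa using (abs_nonneg _).trans (hf 0)
  -- If η < 0, the bound η |s| + K equals -1 at this s.
  have h1 := (abs_nonneg _).trans (hf ((K + 1) / (-η)))
  rw [abs_of_nonneg (div_nonneg (by linarith) (by linarith))] at h1
  have h2 : η * ((K + 1) / (-η)) = -(K + 1) := by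
    rw [div_neg, mul_neg, mul_div_cancel₀ _ hη.ne]
  linarith

/-- Taking ρ-norms in the equilibrium equation gives ‖w‖ ≤ ‖J‖₁ ‖ρ‖_∞ η ‖w‖ + ‖J‖₁ ‖ρ‖_∞² K + ‖h‖_ρ.
Since δ ‖w‖ ≤ ‖w‖, the first term on the right can be absorbed. -/
theorem norm_equilibrium_le {N : ℕ} {ρ : Weight N} {J : EuclideanSpace ℝ (Fin N) → ℝ}
    (hJ0 : ∀ x, 0 ≤ J x) (hJ : Integrable J) {h : EuclideanSpace ℝ (Fin N) → ℝ}
    (hh : ∃ C, ∀ x, |h x| ≤ C) {f : ℝ → ℝ} {η K δ : ℝ} (hf : ∀ s, |f s| ≤ η * |s| + K)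
    (hδ : (∫ x, J x) * ρ.supNorm * η < δ) (hδ_one : δ < 1) {w : CRho ρ}
    (hw : ∀ x, w x = convRho ρ J (fun y => f (w y)) x + h x) :
    ‖w‖ ≤ ((∫ x, J x) * ρ.supNorm ^ 2 * K + rhoNorm ρ h) /
      (δ - (∫ x, J x) * ρ.supNorm * η) := by
  have hη := slope_nonneg_of_abs_le hf
  have hK : 0 ≤ K := by simpa using (abs_nonneg _).trans (hf 0)
  have hI : 0 ≤ ∫ x, J x := integral_nonneg hJ0
  have hs := ρ.supNorm_nonneg
  obtain ⟨C, hC⟩ := hh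
  have hh' : ∀ x, |h x| * ρ x ≤ rhoNorm ρ h := fun x =>
    le_ciSup (f := fun x => |h x| * ρ x) ⟨C * ρ.supNorm, by
      rintro _ ⟨x, rfl⟩
      exact mul_le_mul (hC x) (ρ.le_supNorm x) (ρ.pos x).le ((abs_nonneg _).trans (hC x))⟩ x
  have hA : ∀ y, |f (w y)| * ρ y ≤ η * ‖w‖ + K * ρ.supNorm := fun y => by
    have h1 := mul_le_mul_of_nonneg_right (hf (w y)) (ρ.pos y).le
    have h2 := mul_le_mul_of_nonneg_left (w.le_rhoNorm y) hη
    have h3 := mul_le_mul_of_nonneg_left (ρ.le_supNorm y) hK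
    rw [CRho.norm_def]
    linarith
  have hn : ‖w‖ ≤ (∫ x, J x) * (η * ‖w‖ + K * ρ.supNorm) * ρ.supNorm + rhoNorm ρ h := by
    refine CRho.norm_le_of_forall fun x => ?_
    have h1 := mul_le_mul (abs_convRho_le hJ0 hJ hA x) (ρ.le_supNorm x) (ρ.pos x).le
      (mul_nonneg hI (by positivity))
    have h2 := mul_le_mul_of_nonneg_right
      (abs_add_le (convRho ρ J (fun y => f (w y)) x) (h x)) (ρ.pos x).le
    rw [hw x]
    linarith [hh' x]
  rw [le_div_iff₀ (by linarith)]
  have h1 := mul_le_mul_of_nonneg_left hδ_one.le (norm_nonneg w)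
  linarith

theorem mainTheorem5 (N : ℕ) (ρ : Weight N)
    (J : EuclideanSpace ℝ (Fin N) → ℝ) (hJ_nonneg : ∀ x, 0 ≤ J x) (hJ_int : Integrable J)
    (hJ_even : ∀ x, J (-x) = J x)
    (h : EuclideanSpace ℝ (Fin N) → ℝ) (hh_cont : Continuous h) (hh_bdd : ∃ C, ∀ x, |h x| ≤ C)
    (f : ℝ → ℝ) (hf_lip : ∃ k, LipschitzWith k f) (hf_bdd : ∃ M, ∀ s, |f s| ≤ M)
    (hf_mono : StrictMono f) (hf_diff : Differentiable ℝ f)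
    (η K δ : ℝ) (hf_diss : ∀ s, |f s| ≤ η * |s| + K)
    (hδ : (∫ x, J x) * ρ.supNorm * η < δ) (hδ_one : δ < 1) :
    ∃ T : Flow ℝ (CRho ρ), IsFlowOfEquation ρ J f h T ∧
      ∀ u : CRho ρ,
        omegaLimit atTop T {u} ⊆ equilibriumSet ρ J f h
          (((∫ x, J x) * ρ.supNorm ^ 2 * K + rhoNorm ρ h) /
            (δ - (∫ x, J x) * ρ.supNorm * η)) ∧
        omegaLimit atBot T {u} ⊆ equilibriumSet ρ J f h
          (((∫ x, J x) * ρ.supNorm ^ 2 * K + rhoNorm ρ h) /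
            (δ - (∫ x, J x) * ρ.supNorm * η)) := by
  obtain ⟨k, hk⟩ := hf_lip
  obtain ⟨M, hM⟩ := hf_bdd
  obtain ⟨H, hH⟩ := hh_bdd
  have D : IsFieldData J f h k M H :=
    ⟨hJ_nonneg, hJ_int, hJ_even, hh_cont, hH, hk, hM, hf_mono, hf_diff⟩
  obtain ⟨T, hT⟩ := D.exists_flowOfEquation (ρ := ρ)
  refine ⟨T, hT, fun u => ⟨fun w hw => ?_, fun w hw => ?_⟩⟩
  · have e := D.eq_rhs_of_mem_omegaLimit_atTop hT hw
    exact ⟨norm_equilibrium_le hJ_nonneg hJ_int ⟨H, hH⟩ hf_diss hδ hδ_one e, e⟩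
  · have e := D.eq_rhs_of_mem_omegaLimit_atBot hT hw
    exact ⟨norm_equilibrium_le hJ_nonneg hJ_int ⟨H, hH⟩ hf_diss hδ hδ_one e, e⟩
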